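/- Let $\mathbb F$ be $\mathbb R$ or $\mathbb C$. For $\mathbf A\in\mathbb F^{I\times R}$, $\mathbf B\in\mathbb F^{J\times R}$, $\mathbf C\in\mathbb F^{K\times R}$ with columns $\mathbf a_r,\mathbf b_r,\mathbf c_r$, write $[\mathbf A,\mathbf B,\mathbf C]_R$ for the $I\times J\times K$ tensor $\sum_{r=1}^R\mathbf a_r\circ\mathbf b_r\circ\mathbf c_r$ with entries $\sum_{r=1}^R a_{ir}b_{jr}c_{kr}$. The rank $r_{\mathcal T}$ of a tensor $\mathcal T$ is the least number of rank-one tensors $\mathbf a\circ\mathbf b\circ\mathbf c$ ($\mathbf a,\mathbf b,\mathbf c\neq 0$) whose sum is $\mathcal T$; a decomposition of $\mathcal T$ into $r_{\mathcal T}$ rank-one tensors is a CPD. The third factor matrix of $\mathcal T$ is called unique if for any two CPDs $\mathcal T=[\mathbf A,\mathbf B,\mathbf C]_{r_{\mathcal T}}=[\bar{\mathbf A},\bar{\mathbf B},\bar{\mathbf C}]_{r_{\mathcal T}}$ the matrices $\mathbf C$ and $\bar{\mathbf C}$ coincide up to a permutation and a nonzero scaling of their columns. Further, $r_{\mathbf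 C}$ is the rank of the matrix $\mathbf C$; $k_{\mathbf C}$ is its $k$-rank, the largest number $k\le R$ such that every $k$ columns of $\mathbf C$ are linearly independent; $\mathbf A\odot\mathbf B=[\mathbf a_1\otimes\mathbf b_1\ \dots\ \mathbf a_R\otimes\mathbf b_R]$; and a matrix has full column rank if its columns are linearly independent. For integers $k\ge 1$, $l\ge 0$, let $\mathbf\Phi_{k,l}(\mathbf A,\mathbf B)$ and $\mathbf S_{k+l}(\mathbf C)$ be the matrices with $I^{k+l}J^{k+l}$ and $K^{k+l}$ rows, respectively, whose columns are indexed by the tuples $(r_1,\dots,r_{k+l})$ with $1\le r_1\le\dots\le r_{k+l}\le R$ that contain at least $k$ distinct elements, defined as follows. The entry of $\mathbf\Phi_{k,l}(\mathbf A,\mathbf B)$ in the row indexed by $(i_1,\dots,i_{k+l};j_1,\dots,j_{k+l})$ and the column $(r_1,\dots,r_{k+l})$ is $$\frac1{(k!)^2}\sum_{(s_1,\dots,s_{k+l})}\det\big[a_{i_us_v}\big]_{u,v=1}^k\ \det\big[b_{j_us_v}\big]_{u,v=1}^k\ \prod_{p=k+1}^{k+l}a_{i_ps_p}b_{j_ps_p},$$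 where the sum is over all distinct rearrangements $(s_1,\dots,s_{k+l})$ of $(r_1,\dots,r_{k+l})$ (each of them counted once). The column $(r_1,\dots,r_{k+l})$ of $\mathbf S_{k+l}(\mathbf C)$ is the symmetrization $$\frac1{(k+l)!}\sum_{\sigma}\mathbf c_{r_{\sigma(1)}}\otimes\dots\otimes\mathbf c_{r_{\sigma(k+l)}},$$ where the sum is over all $(k+l)!$ permutations $\sigma$ of $\{1,\dots,k+l\}$. **Theorem.** Let $\mathcal T=[\mathbf A,\mathbf B,\mathbf C]_R$ be an $I\times J\times K$ tensor with $r_{\mathbf C}=K\le R$, let $m=R-K+2$, and let $l_1,\dots,l_m$ be nonnegative integers. For $k=1,\dots,m$ let $\mathbf U_k$ be a matrix whose columns form a basis of $\operatorname{range}(\mathbf S_{k+l_k}(\mathbf C)^T)$. Assume that (i) $k_{\mathbf C}\ge 1$; (ii) $\mathbf A\odot\mathbf B$ has full column rank; (iii) $\mathbf\Phi_{k,l_k}(\mathbf A,\mathbf B)\mathbf U_k$ has full column rank for every $k=1,\dots,m$. Then $r_{\mathcal T}=R$ and the third factor matrix of $\mathcal T$ is unique. -/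

import Mathlib

open scoped BigOperators Nat

namespace CPD

noncomputable section

variable {𝕜 : Type*} [RCLike 𝕜]

/-- The outer product `a ∘ b ∘ c`, with entries `a i * b j * c k`. -/
def outer {I J K : ℕ} (a : Fin I → 𝕜) (b : Fin J → 𝕜) (c : Fin K → 𝕜) :
    Fin I → Fin J → Fin K → 𝕜 :=
  fun i j k => a i * b j * c k

/-- The tensor `[A, B, C]_R`: the sum of the outer products of the corresponding columns. -/
def ofFactors {I J K R : ℕ} (A : Matrix (Fin I) (Fin R) 𝕜) (B : Matrix (Fin J) (Fin R) 𝕜)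
    (C : Matrix (Fin K) (Fin R) 𝕜) : Fin I → Fin J → Fin K → 𝕜 :=
  ∑ r, outer (A.col r) (B.col r) (C.col r)

/-- `T = [A, B, C]_R` is a polyadic decomposition: `T` is the sum of the `R` outer products of
columns, and each of these is a rank-one tensor (its three vectors are nonzero). -/
def IsPD {I J K R : ℕ} (T : Fin I → Fin J → Fin K → 𝕜) (A : Matrix (Fin I) (Fin R) 𝕜)
    (B : Matrix (Fin J) (Fin R) 𝕜) (C : Matrix (Fin K) (Fin R) 𝕜) : Prop :=
  (∀ r, A.col r ≠ 0 ∧ B.col r ≠ 0 ∧ C.col r ≠ 0) ∧ T = ofFactors A B C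

/-- The rank of a tensor: the least number of rank-one tensors that sum to it. -/
def tensorRank {I J K : ℕ} (T : Fin I → Fin J → Fin K → 𝕜) : ℕ :=
  sInf {R : ℕ | ∃ (A : Matrix (Fin I) (Fin R) 𝕜) (B : Matrix (Fin J) (Fin R) 𝕜)
    (C : Matrix (Fin K) (Fin R) 𝕜), IsPD T A B C}

/-- A canonical polyadic decomposition: a polyadic decomposition with `tensorRank T` terms. -/
def IsCPD {I J K R : ℕ} (T : Fin I → Fin J → Fin K → 𝕜) (A : Matrix (Fin I) (Fin R) 𝕜)
    (B : Matrix (Fin J) (Fin R) 𝕜) (C : Matrix (Fin K) (Fin R) 𝕜) : Prop :=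
  IsPD T A B C ∧ R = tensorRank T

/-- Two matrices coincide up to a permutation and a nonzero scaling of the columns. -/
def EqUpToPermScaling {K R : ℕ} (C C' : Matrix (Fin K) (Fin R) 𝕜) : Prop :=
  ∃ (σ : Equiv.Perm (Fin R)) (d : Fin R → 𝕜),
    (∀ r, d r ≠ 0) ∧ ∀ r, C'.col r = d r • C.col (σ r)

/-- The third factor matrices of any two canonical polyadic decompositions of `T` coincide up to
column permutation and scaling. -/
def ThirdFactorUnique {I J K : ℕ} (T : Fin I → Fin J → Fin K → 𝕜) : Prop :=
  ∀ (R : ℕ) (A A' : Matrix (Fin I) (Fin R) 𝕜) (B B' : Matrix (Fin J) (Fin R) 𝕜)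
    (C C' : Matrix (Fin K) (Fin R) 𝕜),
    IsCPD T A B C → IsCPD T A' B' C' → EqUpToPermScaling C C'

/-- The columns of the matrix are linearly independent. -/
def FullColumnRank {ι κ : Type*} (M : Matrix ι κ 𝕜) : Prop :=
  LinearIndependent 𝕜 M.col

/-- The `k`-rank: the largest `k` (at most the number of columns) such that every set of `k`
columns is linearly independent. -/
def kRank {K R : ℕ} (C : Matrix (Fin K) (Fin R) 𝕜) : ℕ :=
  sSup {k : ℕ | k ≤ R ∧ ∀ s : Finset (Fin R), s.card = k →
    LinearIndependent 𝕜 (fun r : s => C.col r)}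

/-- The Khatri-Rao (columnwise Kronecker) product, its rows being indexed by pairs. -/
def khatriRao {I J R : ℕ} (A : Matrix (Fin I) (Fin R) 𝕜) (B : Matrix (Fin J) (Fin R) 𝕜) :
    Matrix (Fin I × Fin J) (Fin R) 𝕜 :=
  Matrix.of fun p r => A p.1 r * B p.2 r

/-- The tuples `r 0 ≤ r 1 ≤ … ≤ r (m + l - 1)` with at least `m` distinct entries, which index
columns. -/
def ColIndex (m l R : ℕ) : Type :=
  {r : Fin (m + l) → Fin R // Monotone r ∧ m ≤ (Finset.univ.image r).card}

instance (m l R : ℕ) : Fintype (ColIndex m l R) :=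
  @Fintype.ofFinite _ (inferInstanceAs (Finite {r : Fin (m + l) → Fin R //
    Monotone r ∧ m ≤ (Finset.univ.image r).card}))

/-- The set of all rearrangements of the tuple `r`, each of them listed once. -/
def rearrangements {n R : ℕ} (r : Fin n → Fin R) : Finset (Fin n → Fin R) :=
  Finset.univ.image fun σ : Equiv.Perm (Fin n) => r ∘ σ

/-- The matrix `Φ_{m,l}(A, B)`. Its rows are indexed by the pairs of tuples
`(i_1, …, i_{m+l})`, `(j_1, …, j_{m+l})`. -/
def Phi {I J R : ℕ} (m l : ℕ) (A : Matrix (Fin I) (Fin R) 𝕜) (B : Matrix (Fin J) (Fin R) 𝕜) :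
    Matrix ((Fin (m + l) → Fin I) × (Fin (m + l) → Fin J)) (ColIndex m l R) 𝕜 :=
  Matrix.of fun p r =>
    (1 / ((m ! : ℕ) : 𝕜) ^ 2) * ∑ s ∈ rearrangements r.1,
      (Matrix.of fun u v : Fin m => A (p.1 (Fin.castAdd l u)) (s (Fin.castAdd l v))).det *
      (Matrix.of fun u v : Fin m => B (p.2 (Fin.castAdd l u)) (s (Fin.castAdd l v))).det *
      ∏ q : Fin l, (A (p.1 (Fin.natAdd m q)) (s (Fin.natAdd m q)) *
        B (p.2 (Fin.natAdd m q)) (s (Fin.natAdd m q)))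

/-- The matrix `S_{m+l}(C)`, whose column `(r_1, …, r_{m+l})` is the symmetrization of
`c_{r_1} ⊗ … ⊗ c_{r_{m+l}}`: the average over all `(m + l)!` permutations. Its rows are indexed by
the tuples `(k_1, …, k_{m+l})`. -/
def S {K R : ℕ} (m l : ℕ) (C : Matrix (Fin K) (Fin R) 𝕜) :
    Matrix (Fin (m + l) → Fin K) (ColIndex m l R) 𝕜 :=
  Matrix.of fun k r =>
    (1 / (((m + l)! : ℕ) : 𝕜)) * ∑ σ : Equiv.Perm (Fin (m + l)), ∏ q, C (k q) (r.1 (σ q))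

/-- The columns of `U` form a basis of the range (column space) of `M`. -/
def IsRangeBasis {ι κ δ : Type*} [Fintype κ] (U : Matrix ι δ 𝕜) (M : Matrix ι κ 𝕜) : Prop :=
  LinearIndependent 𝕜 U.col ∧
    Submodule.span 𝕜 (Set.range U.col) = LinearMap.range M.mulVecLin

end

end CPD

/-! Write ω(d) for the number of nonzero entries of d. For d = Cᵀx the monomials of degree k + l in
d form the vector S(C)ᵀ(x ⊗ ⋯ ⊗ x), which lies in the range spanned by `U k`. By Cauchy-Binet, `Phi`
sends this vector to 0 when all k × k minors of A diag(d) Bᵀ vanish. Full column rank of `Phi * U`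
then makes every monomial zero, so ω(d) < k (`card_support_lt_of_minors_eq_zero`).

A decomposition [A', B', C'] of the same tensor with R' ≤ R terms satisfies A diag(Cᵀx) Bᵀ = A'
diag(C'ᵀx) B'ᵀ, a matrix of rank at most ω(C'ᵀx). Hence ω(Cᵀx) ≤ ω(C'ᵀx) whenever ω(C'ᵀx) ≤ R - K +
1. Kruskal's permutation lemma (`exists_equiv_of_countIn_ker_le`) turns this into a bijection
between the lines spanned by the columns of C' and of C. Its existence gives both R' = R and
uniqueness. -/

namespace CPD

/-! ### Kruskal's permutation lemma over an arbitrary field. -/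

section PermutationLemma

open Module Submodule Finset

variable {F V ι ι' : Type*} [Field F] [AddCommGroup V] [Module F V]

open Classical in
/-- The number of members of the family `v` that lie in the subspace `W`. -/
noncomputable def countIn [Fintype ι] (v : ι → V) (W : Submodule F V) : ℕ :=
  #{i | v i ∈ W}

lemma exists_equiv_of_map_univ_eq {α β γ : Type*} [Fintype α] [Fintype β] {f : α → γ} {g : β → γ}
    (h : Multiset.map f univ.val = Multiset.map g univ.val) : ∃ e : α ≃ β, ∀ a, g (e a) = f a := by
  classical
  have hc : ∀ x, Fintype.card {a // f a = x} = Fintype.card {b // g b = x} := fun x => by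
    have := congrArg (Multiset.count x) h
    rw [Multiset.count_map, Multiset.count_map] at this
    rw [Fintype.card_subtype, Fintype.card_subtype]
    simpa only [Finset.card, Finset.filter_val, eq_comm] using this
  let e : α ≃ β := (Equiv.sigmaFiberEquiv f).symm.trans
    ((Equiv.sigmaCongrRight fun x => Fintype.equivOfCardEq (hc x)).trans (Equiv.sigmaFiberEquiv g))
  exact ⟨e, fun a => (Fintype.equivOfCardEq (hc (f a)) ⟨a, rfl⟩).2⟩

lemma sup_span_singleton_eq_of_covBy {W X : Submodule F V} (h : W ⋖ X) {u : V} (hu : u ∉ W) :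
    W ⊔ F ∙ u = X ↔ u ∈ X := by
  constructor
  · rintro rfl
    exact mem_sup_right (mem_span_singleton_self u)
  · intro huX
    have hlt : W < W ⊔ F ∙ u := by
      refine lt_of_le_of_ne le_sup_left fun h' => hu ?_
      rw [h']
      exact mem_sup_right (mem_span_singleton_self u)
    have hle : W ⊔ F ∙ u ≤ X := sup_le h.le ((span_singleton_le_iff_mem _ _).2 huX)
    exact (h.eq_or_eq hlt.le hle).resolve_left hlt.ne'

open Classical in
lemma countIn_eq_add_of_covBy [Fintype ι] (v : ι → V) {W X : Submodule F V} (h : W ⋖ X) :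
    countIn v X = countIn v W + #{i | v i ∉ W ∧ W ⊔ F ∙ v i = X} := by
  unfold countIn
  rw [← card_union_of_disjoint]
  · congr 1
    ext i
    by_cases hi : v i ∈ W
    · simp [hi, h.le hi]
    · simp [hi, sup_span_singleton_eq_of_covBy h hi]
  · rw [Finset.disjoint_left]
    intro i hi hi'
    simp only [mem_filter, mem_univ, true_and] at hi hi'
    exact hi'.1 hi

open Classical in
lemma countIn_add_card_notMem [Fintype ι] (v : ι → V) (W : Submodule F V) :
    countIn v W + #{i | v i ∉ W} = Fintype.card ι := by
  unfold countIn
  rw [card_filter_add_card_filter_not, card_univ]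

variable [FiniteDimensional F V] [Fintype ι] [Fintype ι']

/-- A hyperplane spanned by members of `v'` contains at least dim V - 1 of them, which is the
threshold in `hyp`. -/
lemma countIn_add_card_le_of_isCoatom (v : ι → V) (v' : ι' → V)
    (hyp : ∀ f : Dual F V, f ≠ 0 → finrank F V ≤ countIn v' (LinearMap.ker f) + 1 →
      countIn v' (LinearMap.ker f) + Fintype.card ι ≤ countIn v (LinearMap.ker f)
        + Fintype.card ι')
    {W : Submodule F V} (hW : W ≤ span F (Set.range v' ∩ W)) (hco : IsCoatom W) :
    countIn v' W + Fintype.card ι ≤ countIn v W + Fintype.card ι' := by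
  classical
  obtain ⟨f, hf, hker⟩ := W.exists_le_ker_of_lt_top hco.lt_top
  have hWf : W = LinearMap.ker f := by
    by_contra hne
    exact hf (LinearMap.ker_eq_top.1 (hco.2 _ (lt_of_le_of_ne hker hne)))
  rw [hWf]
  refine hyp f hf ?_
  have h1 : finrank F W ≤ countIn v' W := by
    have hs : (Set.range v' ∩ W) = ((univ.filter fun i => v' i ∈ W).image v' : Finset V) := by
      ext x
      simp only [Set.mem_inter_iff, Set.mem_range, SetLike.mem_coe, coe_image, coe_filter,
        mem_univ, true_and, Set.mem_image, Set.mem_ofPred_eq]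
      constructor
      · rintro ⟨⟨i, rfl⟩, h⟩
        exact ⟨i, h, rfl⟩
      · rintro ⟨i, h, rfl⟩
        exact ⟨⟨i, rfl⟩, h⟩
    rw [hs] at hW
    exact (Submodule.finrank_mono hW).trans ((finrank_span_finset_le_card _).trans card_image_le)
  have h2 := LinearMap.finrank_range_add_finrank_ker f
  have h3 : finrank F (LinearMap.range f) ≤ 1 := by
    simpa using (LinearMap.range f).finrank_le
  rw [← hWf] at h2 ⊢
  omega

/-- The counting step of Kruskal's permutation lemma. -/
lemma countIn_add_card_le (v : ι → V) (v' : ι' → V) (hv' : span F (Set.range v') = ⊤)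
    (hyp : ∀ f : Dual F V, f ≠ 0 → finrank F V ≤ countIn v' (LinearMap.ker f) + 1 →
      countIn v' (LinearMap.ker f) + Fintype.card ι ≤ countIn v (LinearMap.ker f)
        + Fintype.card ι')
    (W : Submodule F V) (hW : W ≤ span F (Set.range v' ∩ W)) :
    countIn v' W + Fintype.card ι ≤ countIn v W + Fintype.card ι' := by
  classical
  -- Descending induction: the bound is assumed for all strictly larger subspaces.
  induction W using WellFoundedGT.induction with
  | ind W ih =>
  by_cases htop : W = ⊤
  · subst htop
    simp [countIn, add_comm]
  by_cases hco : IsCoatom W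
  · exact countIn_add_card_le_of_isCoatom v v' hyp hW hco
  -- The covers of `W` generated by one more `v' j`. They partition the `v' j` outside `W`, and
  -- their parts outside `W` are disjoint, so each `v i` outside `W` is counted at most once.
  set P : Finset (Submodule F V) :=
    (univ.filter fun j => v' j ∉ W).image fun j => W ⊔ F ∙ v' j with hP
  have hPmem : ∀ X ∈ P, ∃ j, v' j ∉ W ∧ W ⊔ F ∙ v' j = X := fun X hX => by
    simpa [hP] using hX
  have hcov : ∀ X ∈ P, W ⋖ X := fun X hX => by
    obtain ⟨j, hj, rfl⟩ := hPmem X hX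
    exact (by simpa [sup_comm] using covBy_span_singleton_sup hj)
  have hIH : ∀ X ∈ P, countIn v' X + Fintype.card ι ≤ countIn v X + Fintype.card ι' :=
    fun X hX => by
    refine ih X (hcov X hX).lt ?_
    obtain ⟨j, hj, rfl⟩ := hPmem X hX
    refine sup_le (hW.trans (span_mono ?_)) ((span_singleton_le_iff_mem _ _).2 (subset_span ?_))
    · exact Set.inter_subset_inter_right _ (SetLike.coe_subset_coe.2 le_sup_left)
    · exact ⟨⟨j, rfl⟩, mem_sup_right (mem_span_singleton_self _)⟩
  -- Since `v'` spans, no cover would mean `W = ⊤`, and a single cover would be `⊤`, making `W` a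
  -- coatom.
  have hcardP : 2 ≤ #P := by
    by_contra hlt
    have hmem : ∀ X : Submodule F V, (∀ j, v' j ∈ X) → X = ⊤ := fun X hX => by
      rw [eq_top_iff, ← hv', span_le]
      rintro _ ⟨j, rfl⟩
      exact hX j
    have hle : #P ≤ 1 := by omega
    rcases Finset.card_le_one_iff_subset_singleton.1 hle with ⟨X, hX⟩
    by_cases hall : ∀ j, v' j ∈ W
    · exact htop (hmem W hall)
    · push Not at hall
      obtain ⟨j, hj⟩ := hall
      have key : ∀ j, v' j ∉ W → W ⊔ F ∙ v' j = X := fun j hj =>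
        mem_singleton.1 (hX (mem_image_of_mem _ (by simpa using hj)))
      have hXP : X ∈ P := key j hj ▸ mem_image_of_mem _ (by simpa using hj)
      have hXtop : X = ⊤ := hmem X fun i => by
        by_cases hi : v' i ∈ W
        · exact (hcov X hXP).le hi
        · exact (sup_span_singleton_eq_of_covBy (hcov X hXP) hi).1 (key i hi)
      exact hco (covBy_top_iff.1 (hXtop ▸ hcov X hXP))
  have hsum' : ∑ X ∈ P, #{j | v' j ∉ W ∧ W ⊔ F ∙ v' j = X} = #{j | v' j ∉ W} := by
    rw [Finset.card_eq_sum_card_image (fun j => W ⊔ F ∙ v' j)]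
    exact Finset.sum_congr rfl fun X _ => by rw [filter_filter]
  have hsum : ∑ X ∈ P, #{i | v i ∉ W ∧ W ⊔ F ∙ v i = X} ≤ #{i | v i ∉ W} := by
    calc _ = ∑ X ∈ P, #{i ∈ (univ.filter fun i => v i ∉ W) | W ⊔ F ∙ v i = X} :=
          Finset.sum_congr rfl fun X _ => by rw [filter_filter]
      _ = #((univ.filter fun i => v i ∉ W).filter fun i => W ⊔ F ∙ v i ∈ P) := by
          rw [Finset.card_eq_sum_card_fiberwise (f := fun i => W ⊔ F ∙ v i) (t := P)]
          · refine Finset.sum_congr rfl fun X hX => ?_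
            congr 1
            ext i
            simp only [mem_filter, mem_univ, true_and]
            exact ⟨fun h => ⟨⟨h.1, h.2 ▸ hX⟩, h.2⟩, fun h => ⟨h.1.1, h.2⟩⟩
          · intro i hi
            simp only [coe_filter, Set.mem_ofPred_eq] at hi
            exact hi.2
      _ ≤ _ := card_filter_le _ _
  have hall : ∑ X ∈ P, (countIn v' W + #{j | v' j ∉ W ∧ W ⊔ F ∙ v' j = X} + Fintype.card ι) ≤
      ∑ X ∈ P, (countIn v W + #{i | v i ∉ W ∧ W ⊔ F ∙ v i = X} + Fintype.card ι') :=
    Finset.sum_le_sum fun X hX => by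
      rw [← countIn_eq_add_of_covBy v (hcov X hX), ← countIn_eq_add_of_covBy v' (hcov X hX)]
      exact hIH X hX
  simp only [sum_add_distrib, sum_const, smul_eq_mul] at hall
  rw [hsum'] at hall
  have e' := countIn_add_card_notMem v' W
  have e := countIn_add_card_notMem v W
  obtain ⟨p, hp⟩ : ∃ p, #P = p + 2 := ⟨#P - 2, by omega⟩
  rw [hp] at hall
  -- Summing the induction hypothesis over `P` counts `W` itself `#P` times. Substituting the
  -- complements' sizes leaves the claim multiplied by `#P - 1 = p + 1`, which is positive.
  refine le_of_mul_le_mul_left (a := p + 1) ?_ (Nat.succ_pos p)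
  nlinarith

/-- **Kruskal's permutation lemma**, in terms of linear functionals. -/
theorem exists_equiv_of_countIn_ker_le (v : ι → V) (v' : ι' → V) (hv : ∀ i, v i ≠ 0)
    (hcard : Fintype.card ι' ≤ Fintype.card ι) (hv' : span F (Set.range v') = ⊤)
    (hyp : ∀ f : Dual F V, f ≠ 0 → finrank F V ≤ countIn v' (LinearMap.ker f) + 1 →
      countIn v' (LinearMap.ker f) + Fintype.card ι ≤ countIn v (LinearMap.ker f)
        + Fintype.card ι') :
    ∃ e : ι' ≃ ι, ∀ j, F ∙ v' j = F ∙ v (e j) := by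
  classical
  have hcount := countIn_add_card_le v v' hv' hyp
  have hbot : countIn v (⊥ : Submodule F V) = 0 := by
    simp [countIn, hv]
  -- At `⊥` the bound forces equal cardinalities and no zero vector among the `v' j`.
  have h0 := hcount ⊥ bot_le
  have hcard' : Fintype.card ι' = Fintype.card ι := by omega
  have hv0 : ∀ j, v' j ≠ 0 := fun j hj => by
    have : countIn v' (⊥ : Submodule F V) = 0 := by omega
    simp only [countIn, card_eq_zero, filter_eq_empty_iff] at this
    exact this (mem_univ j) (by simpa using hj)
  have hline : ∀ {x y : V}, x ≠ 0 → (x ∈ F ∙ y ↔ F ∙ y = F ∙ x) := fun {x y} hx => by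
    constructor
    · intro h
      obtain ⟨a, rfl⟩ := mem_span_singleton.1 h
      have ha : a ≠ 0 := fun h0 => hx (by simp [h0])
      rw [span_singleton_smul_eq (IsUnit.mk0 a ha)]
    · intro h
      rw [h]
      exact mem_span_singleton_self x
  -- Applied to lines, the bound compares multiplicities; equal cardinality then upgrades `≤` to
  -- equality of multisets.
  have hle : Multiset.map (fun j => F ∙ v' j) univ.val ≤
      Multiset.map (fun i => F ∙ v i) univ.val := by
    rw [Multiset.le_iff_count]
    intro X
    by_cases hX : X ∈ Multiset.map (fun j => F ∙ v' j) univ.val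
    · obtain ⟨j, -, rfl⟩ := Multiset.mem_map.1 hX
      have h := hcount (F ∙ v' j) ((span_singleton_le_iff_mem _ _).2
        (subset_span ⟨⟨_, rfl⟩, mem_span_singleton_self _⟩))
      rw [Multiset.count_map, Multiset.count_map]
      simp only [countIn, hline (hv _), hline (hv0 _)] at h
      exact Nat.le_of_add_le_add_right (hcard' ▸ h)
    · rw [Multiset.count_eq_zero_of_notMem hX]
      exact Nat.zero_le _
  obtain ⟨e, he⟩ := exists_equiv_of_map_univ_eq
    (Multiset.eq_of_le_of_card_le hle (by simp [hcard']))
  exact ⟨e, fun j => (he j).symm⟩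

end PermutationLemma

end CPD

namespace CPD

/-! ### From the matrices `Phi` and `S` to the support of Cᵀx. -/

section CompoundMatrices

variable {𝕜 : Type*} [RCLike 𝕜] {I J K R : ℕ}

/-- Each tuple has exactly one monotone rearrangement; `hF` disposes of the tuples with too few
distinct entries to belong to a column. -/
lemma sum_colIndex_rearrangements {m l : ℕ} {M : Type*} [AddCommMonoid M]
    (F : (Fin (m + l) → Fin R) → M)
    (hF : ∀ s, (Finset.univ.image s).card < m → F s = 0) :
    ∑ r : ColIndex m l R, ∑ s ∈ rearrangements r.1, F s = ∑ s, F s := by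
  classical
  rw [← Finset.sum_biUnion]
  · refine Finset.sum_subset (Finset.subset_univ _) fun s _ hs => hF s ?_
    by_contra! hcard
    refine hs (Finset.mem_biUnion.2 ⟨⟨s ∘ Tuple.sort s, Tuple.monotone_sort s, ?_⟩,
      Finset.mem_univ _, Finset.mem_image.2 ⟨(Tuple.sort s)⁻¹, Finset.mem_univ _, ?_⟩⟩)
    · rw [← Finset.image_image, Finset.image_univ_equiv]
      exact hcard
    · ext q
      simp
  · intro r _ r' _ hne
    rw [Function.onFun, Finset.disjoint_left]
    intro s hs hs'
    obtain ⟨σ, -, hσ⟩ := Finset.mem_image.1 hs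
    obtain ⟨τ, -, hτ⟩ := Finset.mem_image.1 hs'
    refine hne (Subtype.ext ?_)
    have h1 : s ∘ (σ⁻¹ : Equiv.Perm _) = r.1 := by
      ext q
      simp [← hσ]
    have h2 : s ∘ (τ⁻¹ : Equiv.Perm _) = r'.1 := by
      ext q
      simp [← hτ]
    rw [← h1, ← h2]
    exact Tuple.unique_monotone (h1 ▸ r.2.1) (h2 ▸ r'.2.1)

/-- A form of the Cauchy-Binet formula, the sum being over all tuples of indices. -/
lemma sum_det_mul_det_mul_prod {k : ℕ} (A : Matrix (Fin I) (Fin R) 𝕜)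
    (B : Matrix (Fin J) (Fin R) 𝕜) (d : Fin R → 𝕜) (i : Fin k → Fin I) (j : Fin k → Fin J) :
    ∑ t : Fin k → Fin R, (A.submatrix i t).det * (B.submatrix j t).det * ∏ q, d (t q) =
      (k ! : ℕ) * ((A * Matrix.diagonal d * B.transpose).submatrix i j).det := by
  -- Each term of the Leibniz expansion of the B-minor contributes the same determinant: its sign
  -- cancels against that of the permuted columns.
  have key : ∀ σ : Equiv.Perm (Fin k),
      ∑ t : Fin k → Fin R, (A.submatrix i t).det * (∏ q, B (j (σ q)) (t q)) * ∏ q, d (t q) =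
        Equiv.Perm.sign σ * ((A * Matrix.diagonal d * B.transpose).submatrix i j).det := by
    intro σ
    rw [← Matrix.det_permute' σ, ← Matrix.det_transpose]
    have h := (Matrix.detRowAlternating (n := Fin k) (R := 𝕜)).toMultilinearMap.map_sum
      (fun (q : Fin k) (r : Fin R) (u : Fin k) => B (j (σ q)) r * d r * A (i u) r)
    have h1 : (((A * Matrix.diagonal d * B.transpose).submatrix i j).submatrix id σ).transpose =
        Matrix.of fun (q : Fin k) => ∑ r, fun u => B (j (σ q)) r * d r * A (i u) r := by
      ext q u
      simp only [Matrix.transpose_apply, Matrix.submatrix_apply, Matrix.mul_apply,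
        Matrix.of_apply, Finset.sum_apply, Matrix.diagonal_apply, id]
      refine Finset.sum_congr rfl fun r _ => ?_
      simp
      ring
    rw [h1]
    refine Eq.trans ?_ h.symm
    refine Finset.sum_congr rfl fun t _ => ?_
    have h2 := Matrix.det_mul_column (fun q => B (j (σ q)) (t q) * d (t q))
      (A.submatrix i t).transpose
    rw [Matrix.det_transpose] at h2
    rw [mul_assoc, ← Finset.prod_mul_distrib, mul_comm]
    exact h2.symm
  calc _ = ∑ t : Fin k → Fin R, ∑ σ : Equiv.Perm (Fin k), (Equiv.Perm.sign σ : 𝕜) *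
        ((A.submatrix i t).det * (∏ q, B (j (σ q)) (t q)) * ∏ q, d (t q)) := by
        refine Finset.sum_congr rfl fun t _ => ?_
        rw [Matrix.det_apply' (B.submatrix j t), Finset.mul_sum, Finset.sum_mul]
        refine Finset.sum_congr rfl fun σ _ => ?_
        simp only [Matrix.submatrix_apply]
        ring
    _ = ∑ σ : Equiv.Perm (Fin k), ((A * Matrix.diagonal d * B.transpose).submatrix i j).det := by
        rw [Finset.sum_comm]
        refine Finset.sum_congr rfl fun σ _ => ?_
        rw [← Finset.mul_sum, key, ← mul_assoc, ← Int.cast_mul, ← Units.val_mul,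
          Int.units_mul_self]
        simp
    _ = _ := by
        simp [Finset.card_univ, Fintype.card_perm]

/-- The vector of the products `d r_1 ⋯ d r_{m+l}`. -/
def monomialVec (m l : ℕ) (d : Fin R → 𝕜) : ColIndex m l R → 𝕜 :=
  fun r => ∏ q, d (r.1 q)

lemma Phi_mulVec_monomialVec (m l : ℕ) (A : Matrix (Fin I) (Fin R) 𝕜)
    (B : Matrix (Fin J) (Fin R) 𝕜) (d : Fin R → 𝕜)
    (h : ∀ (i : Fin m → Fin I) (j : Fin m → Fin J),
      ((A * Matrix.diagonal d * B.transpose).submatrix i j).det = 0) :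
    (Phi m l A B).mulVec (monomialVec m l d) = 0 := by
  ext ⟨i, j⟩
  let F : (Fin (m + l) → Fin R) → 𝕜 := fun s =>
    ((A.submatrix (fun u => i (Fin.castAdd l u)) fun v => s (Fin.castAdd l v)).det *
      (B.submatrix (fun u => j (Fin.castAdd l u)) fun v => s (Fin.castAdd l v)).det *
      ∏ q : Fin l, (A (i (Fin.natAdd m q)) (s (Fin.natAdd m q)) *
        B (j (Fin.natAdd m q)) (s (Fin.natAdd m q)))) * ∏ q, d (s q)
  have hF : ∀ s, (Finset.univ.image s).card < m → F s = 0 := by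
    intro s hs
    have hinj : ¬ Function.Injective fun v : Fin m => s (Fin.castAdd l v) := fun hinj => by
      have h1 := Finset.card_image_of_injective Finset.univ hinj
      have h2 : (Finset.univ.image fun v : Fin m => s (Fin.castAdd l v)) ⊆
          Finset.univ.image s := by
        intro x hx
        obtain ⟨v, -, rfl⟩ := Finset.mem_image.1 hx
        exact Finset.mem_image_of_mem _ (Finset.mem_univ _)
      have h3 := Finset.card_le_card h2
      rw [h1, Finset.card_univ, Fintype.card_fin] at h3
      omega
    simp only [Function.Injective, not_forall] at hinj
    obtain ⟨u, v, huv, hne⟩ := hinj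
    have hdet : (A.submatrix (fun u => i (Fin.castAdd l u))
        fun v => s (Fin.castAdd l v)).det = 0 :=
      Matrix.det_zero_of_column_eq hne fun w => by simp [huv]
    simp [F, hdet]
  have h1 : (Phi m l A B).mulVec (monomialVec m l d) (i, j) =
      (1 / ((m ! : ℕ) : 𝕜) ^ 2) * ∑ r : ColIndex m l R, ∑ s ∈ rearrangements r.1, F s := by
    rw [Matrix.mulVec, dotProduct, Finset.mul_sum]
    refine Finset.sum_congr rfl fun r _ => ?_
    rw [Phi, Matrix.of_apply, mul_assoc, Finset.sum_mul]
    congr 1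
    refine Finset.sum_congr rfl fun s hs => ?_
    obtain ⟨σ, -, rfl⟩ := Finset.mem_image.1 hs
    have : monomialVec m l d r = ∏ q, d ((r.1 ∘ σ) q) :=
      (Equiv.prod_comp σ fun q => d (r.1 q)).symm
    rw [this]
    rfl
  -- Split each tuple into its first m entries `t` and last l entries `w`. For fixed `w`, the sum
  -- over `t` is a multiple of an m × m minor.
  rw [h1, sum_colIndex_rearrangements F hF, ← (Fin.appendEquiv m l).sum_comp,
    Fintype.sum_prod_type_right]
  rw [Finset.sum_eq_zero, mul_zero, Pi.zero_apply]
  intro w _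
  have h2 : ∀ t : Fin m → Fin R, F (Fin.appendEquiv m l (t, w)) =
      ((A.submatrix (fun u => i (Fin.castAdd l u)) t).det *
        (B.submatrix (fun u => j (Fin.castAdd l u)) t).det * ∏ q, d (t q)) *
      ((∏ q : Fin l, (A (i (Fin.natAdd m q)) (w q) * B (j (Fin.natAdd m q)) (w q))) *
        ∏ q, d (w q)) := by
    intro t
    simp only [F, Fin.appendEquiv, Equiv.coe_fn_mk, Fin.append_left, Fin.append_right,
      Fin.prod_univ_add]
    ring
  simp only [h2]
  rw [← Finset.sum_mul, sum_det_mul_det_mul_prod, h, mul_zero, zero_mul]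

/-- As x ⊗ ⋯ ⊗ x is symmetric, all permutations in the symmetrization contribute equally. -/
lemma S_transpose_mulVec (m l : ℕ) (C : Matrix (Fin K) (Fin R) 𝕜) (x : Fin K → 𝕜) :
    (S m l C).transpose.mulVec (fun κ => ∏ q, x (κ q)) =
      monomialVec m l (C.transpose.mulVec x) := by
  ext r
  have hfact : (((m + l)! : ℕ) : 𝕜) ≠ 0 := Nat.cast_ne_zero.2 (Nat.factorial_ne_zero _)
  have h : ∀ σ : Equiv.Perm (Fin (m + l)),
      ∑ κ : Fin (m + l) → Fin K, (∏ q, C (κ q) (r.1 (σ q))) * ∏ q, x (κ q) =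
        monomialVec m l (C.transpose.mulVec x) r := by
    intro σ
    rw [monomialVec, ← Equiv.prod_comp σ]
    simp only [Matrix.mulVec, dotProduct, Matrix.transpose_apply, ← Finset.prod_mul_distrib]
    rw [Finset.prod_univ_sum, Fintype.piFinset_univ]
  simp only [Matrix.mulVec, dotProduct, Matrix.transpose_apply, S, Matrix.of_apply, mul_assoc,
    Finset.sum_mul] at h ⊢
  rw [← Finset.mul_sum, Finset.sum_comm, Finset.sum_congr rfl fun σ _ => h σ]
  simp only [Finset.sum_const, Finset.card_univ, Fintype.card_perm, Fintype.card_fin,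
    nsmul_eq_mul]
  field_simp

lemma exists_colIndex_of_le_card {k l : ℕ} (hk : 1 ≤ k) {s : Finset (Fin R)} (hs : k ≤ s.card) :
    ∃ r : ColIndex k l R, ∀ q, r.1 q ∈ s := by
  obtain ⟨s', hs', hcard⟩ := Finset.exists_subset_card_eq hs
  let e := s'.orderEmbOfFin hcard
  -- k distinct elements of `s`, padded by l copies of the first one, which exists because `1 ≤ k`.
  let t : Fin (k + l) → Fin R := Fin.append e fun _ => e ⟨0, hk⟩
  have ht : ∀ q, t q ∈ s := fun q => hs' <| by
    induction q using Fin.addCases with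
    | left q => simpa only [t, Fin.append_left] using s'.orderEmbOfFin_mem hcard q
    | right q => simpa only [t, Fin.append_right] using s'.orderEmbOfFin_mem hcard ⟨0, hk⟩
  refine ⟨⟨t ∘ Tuple.sort t, Tuple.monotone_sort t, ?_⟩, fun q => ht _⟩
  rw [← Finset.image_image, Finset.image_univ_equiv]
  calc k = (Finset.univ.image e).card := by
        rw [Finset.card_image_of_injective _ e.injective]
        simp
    _ ≤ _ := Finset.card_le_card fun x hx => by
        obtain ⟨q, -, rfl⟩ := Finset.mem_image.1 hx
        exact Finset.mem_image.2 ⟨Fin.castAdd l q, Finset.mem_univ _, by simp [t]⟩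

/-- If all `k × k` minors of `A diag(Cᵀx) Bᵀ` vanish, then `Cᵀx` has less than `k` nonzero
entries. -/
theorem card_support_lt_of_minors_eq_zero {k l n : ℕ} (hk : 1 ≤ k) (A : Matrix (Fin I) (Fin R) 𝕜)
    (B : Matrix (Fin J) (Fin R) 𝕜) (C : Matrix (Fin K) (Fin R) 𝕜)
    (U : Matrix (ColIndex k l R) (Fin n) 𝕜) (hU : IsRangeBasis U (S k l C).transpose)
    (hPhi : FullColumnRank (Phi k l A B * U)) (x : Fin K → 𝕜)
    (h : ∀ (i : Fin k → Fin I) (j : Fin k → Fin J),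
      ((A * Matrix.diagonal (C.transpose.mulVec x) * B.transpose).submatrix i j).det = 0) :
    (Finset.univ.filter fun r => C.transpose.mulVec x r ≠ 0).card < k := by
  by_contra! hcard
  obtain ⟨r, hr⟩ := exists_colIndex_of_le_card (l := l) hk hcard
  have hmem : monomialVec k l (C.transpose.mulVec x) ∈
      Submodule.span 𝕜 (Set.range U.col) := by
    rw [hU.2]
    exact ⟨_, S_transpose_mulVec k l C x⟩
  rw [← Matrix.range_mulVecLin] at hmem
  obtain ⟨y, hy⟩ := hmem
  rw [Matrix.mulVecLin_apply] at hy
  have hy0 : y = 0 := by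
    refine Matrix.mulVec_injective_iff.2 hPhi ?_
    rw [← Matrix.mulVec_mulVec, hy, Phi_mulVec_monomialVec k l A B _ h, Matrix.mulVec_zero]
  have h0 : monomialVec k l (C.transpose.mulVec x) r = 0 := by
    rw [← hy, hy0, Matrix.mulVec_zero, Pi.zero_apply]
  obtain ⟨q, -, hq⟩ := Finset.prod_eq_zero_iff.1 h0
  exact (Finset.mem_filter.1 (hr q)).2 hq

end CompoundMatrices

end CPD

namespace CPD

/-! ### Comparison of two decompositions of the same tensor. -/

section Uniqueness

open Module

variable {𝕜 : Type*} [RCLike 𝕜] {I J K R R' : ℕ}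

lemma mul_diagonal_mul_transpose_eq_of_ofFactors_eq
    {A : Matrix (Fin I) (Fin R) 𝕜} {B : Matrix (Fin J) (Fin R) 𝕜} {C : Matrix (Fin K) (Fin R) 𝕜}
    {A' : Matrix (Fin I) (Fin R') 𝕜} {B' : Matrix (Fin J) (Fin R') 𝕜}
    {C' : Matrix (Fin K) (Fin R') 𝕜} (h : ofFactors A B C = ofFactors A' B' C') (x : Fin K → 𝕜) :
    A * Matrix.diagonal (C.transpose.mulVec x) * B.transpose =
      A' * Matrix.diagonal (C'.transpose.mulVec x) * B'.transpose := by
  have key : ∀ {n : ℕ} (A : Matrix (Fin I) (Fin n) 𝕜) (B : Matrix (Fin J) (Fin n) 𝕜)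
      (C : Matrix (Fin K) (Fin n) 𝕜) (i : Fin I) (j : Fin J),
      (A * Matrix.diagonal (C.transpose.mulVec x) * B.transpose) i j =
        ∑ k, ofFactors A B C i j k * x k := by
    intro n A B C i j
    simp only [ofFactors, outer, Finset.sum_apply, Finset.sum_mul]
    rw [Finset.sum_comm, Matrix.mul_apply]
    refine Finset.sum_congr rfl fun r _ => ?_
    rw [Matrix.mul_diagonal, Matrix.mulVec, dotProduct, Finset.mul_sum, Finset.sum_mul]
    refine Finset.sum_congr rfl fun k _ => ?_
    simp only [Matrix.transpose_apply, Matrix.col_apply]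
    ring
  ext i j
  rw [key, key, h]

lemma det_submatrix_eq_zero_of_card_support_lt {k : ℕ} (A : Matrix (Fin I) (Fin R) 𝕜)
    (B : Matrix (Fin J) (Fin R) 𝕜) (d : Fin R → 𝕜)
    (hd : (Finset.univ.filter fun r => d r ≠ 0).card < k) (i : Fin k → Fin I) (j : Fin k → Fin J) :
    ((A * Matrix.diagonal d * B.transpose).submatrix i j).det = 0 := by
  by_contra hne
  have h1 := Matrix.rank_of_isUnit _ ((Matrix.isUnit_iff_isUnit_det _).2 (isUnit_iff_ne_zero.2 hne))
  have h2 : (A * Matrix.diagonal d * B.transpose).submatrix i j =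
      A.submatrix i id * Matrix.diagonal d * B.transpose.submatrix id j := by
    ext u v
    simp [Matrix.mul_apply]
  rw [h2, Fintype.card_fin] at h1
  have h3 := (Matrix.rank_mul_le_left (A.submatrix i id * Matrix.diagonal d)
    (B.transpose.submatrix id j)).trans (Matrix.rank_mul_le_right _ _)
  rw [h1, Matrix.rank_diagonal, Fintype.card_subtype] at h3
  omega

lemma eq_zero_of_mul_diagonal_mul_transpose_eq_zero {A : Matrix (Fin I) (Fin R) 𝕜}
    {B : Matrix (Fin J) (Fin R) 𝕜} (hAB : FullColumnRank (khatriRao A B)) {d : Fin R → 𝕜}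
    (h : A * Matrix.diagonal d * B.transpose = 0) : d = 0 := by
  refine Matrix.mulVec_injective_iff.2 hAB ?_
  rw [Matrix.mulVec_zero]
  ext ⟨i, j⟩
  have hij := congrFun (congrFun h i) j
  rw [Matrix.mul_apply] at hij
  refine Eq.trans ?_ hij
  rw [Matrix.mulVec, dotProduct]
  refine Finset.sum_congr rfl fun r _ => ?_
  simp only [khatriRao, Matrix.of_apply, Matrix.mul_diagonal, Matrix.transpose_apply]
  ring

/-- The vector `x` is chosen before the matrix, so one `x` serves both C and C'. -/
lemma exists_transpose_mulVec_eq (f : Dual 𝕜 (Fin K → 𝕜)) :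
    ∃ x : Fin K → 𝕜, ∀ {n : ℕ} (C : Matrix (Fin K) (Fin n) 𝕜) (r : Fin n),
      C.transpose.mulVec x r = f (C.col r) := by
  refine ⟨fun k => f fun j => if k = j then 1 else 0, fun C r => ?_⟩
  rw [LinearMap.pi_apply_eq_sum_univ f]
  rfl

lemma col_ne_zero_of_one_le_kRank {C : Matrix (Fin K) (Fin R) 𝕜} (h : 1 ≤ kRank C) (r : Fin R) :
    C.col r ≠ 0 := by
  have hmem : kRank C ∈ {k : ℕ | k ≤ R ∧ ∀ s : Finset (Fin R), s.card = k →
      LinearIndependent 𝕜 (fun r : s => C.col r)} :=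
    -- The set contains 0 and is bounded by R, so the supremum is attained.
    Nat.sSup_mem ⟨0, Nat.zero_le _, fun s hs => by
      obtain rfl := Finset.card_eq_zero.1 hs
      exact linearIndependent_empty_type⟩ ⟨R, fun k hk => hk.1⟩
  obtain ⟨s, hrs, hs⟩ := Finset.exists_superset_card_eq (s := {r}) (n := kRank C) (by simpa using h)
    (by simpa using hmem.1)
  exact (hmem.2 s hs).ne_zero ⟨r, hrs (Finset.mem_singleton_self r)⟩

lemma col_ne_zero_of_fullColumnRank_khatriRao {A : Matrix (Fin I) (Fin R) 𝕜}
    {B : Matrix (Fin J) (Fin R) 𝕜} (hAB : FullColumnRank (khatriRao A B)) (r : Fin R) :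
    A.col r ≠ 0 ∧ B.col r ≠ 0 := by
  constructor <;> intro h0 <;> refine LinearIndependent.ne_zero r hAB ?_ <;> ext p
  · have : A p.1 r = 0 := congrFun h0 p.1
    simp [khatriRao, this]
  · have : B p.2 r = 0 := congrFun h0 p.2
    simp [khatriRao, this]

lemma span_range_col_eq_top {C : Matrix (Fin K) (Fin R) 𝕜} (h : C.rank = K) :
    Submodule.span 𝕜 (Set.range C.col) = ⊤ := by
  rw [← Matrix.range_mulVecLin]
  apply Submodule.eq_top_of_finrank_eq
  rw [finrank_fin_fun]
  exact h

lemma linearMap_eq_zero_of_forall_col {C : Matrix (Fin K) (Fin R) 𝕜}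
    (h : Submodule.span 𝕜 (Set.range C.col) = ⊤) {f : Dual 𝕜 (Fin K → 𝕜)}
    (hf : ∀ r, f (C.col r) = 0) : f = 0 := by
  refine LinearMap.ker_eq_top.1 (top_le_iff.1 (h ▸ Submodule.span_le.2 ?_))
  rintro _ ⟨r, rfl⟩
  exact hf r

/-- The third factor of any polyadic decomposition with at most `R` terms agrees with `C`, if
`A diag(Cᵀx) Bᵀ` satisfies the rank conditions of Kruskal's permutation lemma. -/
theorem exists_equiv_span_col_eq {A : Matrix (Fin I) (Fin R) 𝕜} {B : Matrix (Fin J) (Fin R) 𝕜}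
    {C : Matrix (Fin K) (Fin R) 𝕜} (hrank : C.rank = K) (hKR : K ≤ R) (hC : ∀ r, C.col r ≠ 0)
    (hAB : FullColumnRank (khatriRao A B))
    (hW : ∀ k ∈ Finset.Icc 1 (R - K + 2), ∀ x : Fin K → 𝕜,
      (∀ (i : Fin k → Fin I) (j : Fin k → Fin J),
        ((A * Matrix.diagonal (C.transpose.mulVec x) * B.transpose).submatrix i j).det = 0) →
      (Finset.univ.filter fun r => C.transpose.mulVec x r ≠ 0).card < k)
    {A' : Matrix (Fin I) (Fin R') 𝕜} {B' : Matrix (Fin J) (Fin R') 𝕜}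
    {C' : Matrix (Fin K) (Fin R') 𝕜} (h : ofFactors A B C = ofFactors A' B' C') (hR : R' ≤ R) :
    ∃ e : Fin R' ≃ Fin R, ∀ j, Submodule.span 𝕜 {C'.col j} = Submodule.span 𝕜 {C.col (e j)} := by
  classical
  refine exists_equiv_of_countIn_ker_le C.col C'.col hC (by simpa using hR) ?_ ?_
  -- A functional vanishing on all columns of C' gives A diag(Cᵀx) Bᵀ = 0. Independence of the
  -- columns of A ⊙ B forces Cᵀx = 0, and C has full row rank.
  · by_contra hne
    obtain ⟨f, hf, hker⟩ := Submodule.exists_le_ker_of_lt_top _ (lt_top_iff_ne_top.2 hne)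
    obtain ⟨x, hx⟩ := exists_transpose_mulVec_eq f
    have h0 : C'.transpose.mulVec x = 0 := funext fun j => by
      rw [hx]
      exact hker (Submodule.subset_span ⟨j, rfl⟩)
    have h1 := mul_diagonal_mul_transpose_eq_of_ofFactors_eq h x
    rw [h0, Pi.zero_def, Matrix.diagonal_zero, Matrix.mul_zero, Matrix.zero_mul] at h1
    have h2 := eq_zero_of_mul_diagonal_mul_transpose_eq_zero hAB h1
    exact hf (linearMap_eq_zero_of_forall_col (span_range_col_eq_top hrank) fun r => by
      rw [← hx, h2, Pi.zero_apply])
  · intro f hf hcount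
    obtain ⟨x, hx⟩ := exists_transpose_mulVec_eq f
    have e := countIn_add_card_notMem C.col (LinearMap.ker f)
    have e' := countIn_add_card_notMem C'.col (LinearMap.ker f)
    rw [finrank_fin_fun] at hcount
    simp only [LinearMap.mem_ker, ← hx, Fintype.card_fin] at e e'
    -- Take k = ω(C'ᵀx) + 1. As at least K - 1 columns of C' lie in the kernel and R' ≤ R, this k is
    -- at most R - K + 2.
    have := hW ((Finset.univ.filter fun r => C'.transpose.mulVec x r ≠ 0).card + 1)
      (Finset.mem_Icc.2 ⟨by omega, by simp only [ne_eq]; omega⟩) x fun i j => by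
        rw [mul_diagonal_mul_transpose_eq_of_ofFactors_eq h x]
        exact det_submatrix_eq_zero_of_card_support_lt _ _ _ (Nat.lt_succ_self _) i j
    simp only [ne_eq] at this
    simp only [Fintype.card_fin]
    omega

end Uniqueness

end CPD

/-! ### Rank and uniqueness of the third factor. -/

theorem mainTheorem3 {𝕜 : Type*} [RCLike 𝕜] {I J K R : ℕ}
    (T : Fin I → Fin J → Fin K → 𝕜)
    (A : Matrix (Fin I) (Fin R) 𝕜) (B : Matrix (Fin J) (Fin R) 𝕜) (C : Matrix (Fin K) (Fin R) 𝕜)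
    (hT : T = CPD.ofFactors A B C)
    (hrank : C.rank = K) (hKR : K ≤ R)
    (m : ℕ) (hm : m = R - K + 2)
    (l : ℕ → ℕ) (d : ℕ → ℕ)
    (U : ∀ k : ℕ, Matrix (CPD.ColIndex k (l k) R) (Fin (d k)) 𝕜)
    (hU : ∀ k ∈ Finset.Icc 1 m, CPD.IsRangeBasis (U k) (CPD.S k (l k) C).transpose)
    (hkC : 1 ≤ CPD.kRank C)
    (hAB : CPD.FullColumnRank (CPD.khatriRao A B))
    (hPhi : ∀ k ∈ Finset.Icc 1 m, CPD.FullColumnRank (CPD.Phi k (l k) A B * U k)) :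
    CPD.tensorRank T = R ∧ CPD.ThirdFactorUnique T := by
  subst hm hT
  have hC := CPD.col_ne_zero_of_one_le_kRank hkC
  have hAB0 := CPD.col_ne_zero_of_fullColumnRank_khatriRao hAB
  have key : ∀ {R' : ℕ} {A' : Matrix (Fin I) (Fin R') 𝕜} {B' : Matrix (Fin J) (Fin R') 𝕜}
      {C' : Matrix (Fin K) (Fin R') 𝕜}, CPD.IsPD (CPD.ofFactors A B C) A' B' C' → R' ≤ R →
      ∃ e : Fin R' ≃ Fin R, ∀ j,
        Submodule.span 𝕜 {C'.col j} = Submodule.span 𝕜 {C.col (e j)} := fun h hR =>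
    CPD.exists_equiv_span_col_eq hrank hKR hC hAB (fun k hk x hx =>
      CPD.card_support_lt_of_minors_eq_zero (Finset.mem_Icc.1 hk).1 A B C (U k) (hU k hk)
        (hPhi k hk) x hx) h.2 hR
  have hmem : R ∈ {R : ℕ | ∃ (A' : Matrix (Fin I) (Fin R) 𝕜) (B' : Matrix (Fin J) (Fin R) 𝕜)
      (C' : Matrix (Fin K) (Fin R) 𝕜), CPD.IsPD (CPD.ofFactors A B C) A' B' C'} :=
    ⟨A, B, C, fun r => ⟨(hAB0 r).1, (hAB0 r).2, hC r⟩, rfl⟩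
  have hle : CPD.tensorRank (CPD.ofFactors A B C) ≤ R := Nat.sInf_le hmem
  constructor
  -- A minimal decomposition has at most R terms, and the bijection forces exactly R.
  · obtain ⟨A', B', C', h⟩ := Nat.sInf_mem ⟨R, hmem⟩
    obtain ⟨e, -⟩ := key h hle
    exact Fin.equiv_iff_eq.1 ⟨e⟩
  · intro R₀ A₁ A₂ B₁ B₂ C₁ C₂ h₁ h₂
    -- Both CPDs are compared with C, and the two bijections are composed.
    obtain ⟨e₁, he₁⟩ := key h₁.1 (h₁.2.trans_le hle)
    obtain ⟨e₂, he₂⟩ := key h₂.1 (h₁.2.trans_le hle)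
    have h : ∀ r, ∃ z : 𝕜ˣ, z • C₁.col (e₁.symm (e₂ r)) = C₂.col r := fun r => by
      rw [← Submodule.span_singleton_eq_span_singleton, he₁, he₂, Equiv.apply_symm_apply]
    choose z hz using h
    exact ⟨e₂.trans e₁.symm, fun r => z r, fun r => (z r).ne_zero, fun r => (hz r).symm⟩
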